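/- Let $m\ge 1$ be an integer with $m\not\equiv 1\pmod 3$, let $n=3m$, and regard $\mathbb F_{2^m}$ as the subfield of order $2^m$ of $\mathbb F_{2^n}$. For $\delta\in\mathbb F_{2^n}$ let $$F(X)=(X^{2^m}+X+\delta)^{2^{2m-1}+2^{m-1}}+X,$$ viewed as a function $\mathbb F_{2^n}\to\mathbb F_{2^n}$, and let $\mathrm{Tr}_m^{3m}(x)=x+x^{2^m}+x^{2^{2m}}$. For $c\in\mathbb F_{2^n}$ the $c$-differential uniformity of $F$ is $${}_c\Delta_F=\max\bigl\{\#\{x\in\mathbb F_{2^n}: F(x+a)-cF(x)=b\}\;:\;a,b\in\mathbb F_{2^n},\ a\ne 0\text{ if }c=1\bigr\};$$ $F$ is called P$c$N if ${}_c\Delta_F=1$ and AP$c$N if ${}_c\Delta_F=2$. Then: 1. $F$ is P$c$N for all $c\in\mathbb F_{2^m}\setminus\{1\}$ and all $\delta\in\mathbb F_{2^n}$; 2. $F$ is AP$c$N for all $c\in\mathbb F_{2^n}\setminus\mathbb F_{2^m}$ and all $\delta\in\mathbb F_{2^n}$ with $\mathrm{Tr}_m^{3m}(\delta)=0$; 3.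 ${}_c\Delta_F\le 4$ for all $c\in\mathbb F_{2^n}\setminus\mathbb F_{2^m}$ and all $\delta\in\mathbb F_{2^n}$ with $\mathrm{Tr}_m^{3m}(\delta)\ne 0$. -/

import Mathlib

namespace CDiff

/-- The `c`-DDT entry at `(a, b)`: the number of solutions `x` of `F (x + a) - c * F x = b`. -/
noncomputable def ddt {K : Type*} [Field K] (F : K → K) (c a b : K) : ℕ :=
  Nat.card {x : K // F (x + a) - c * F x = b}

open Classical in
/-- The `c`-differential uniformity of `F` over a finite field: the maximum of the `c`-DDT entries
over all pairs `(a, b)`, where `a ≠ 0` is required if `c = 1`. -/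
noncomputable def cUniformity {K : Type*} [Field K] [Fintype K] (F : K → K) (c : K) : ℕ :=
  ((Finset.univ : Finset (K × K)).filter (fun p => c = 1 → p.1 ≠ 0)).sup
    (fun p => ddt F c p.1 p.2)

/-- Perfect `c`-nonlinear functions. -/
def IsPcN {K : Type*} [Field K] [Fintype K] (F : K → K) (c : K) : Prop :=
  cUniformity F c = 1

/-- Almost perfect `c`-nonlinear functions. -/
def IsAPcN {K : Type*} [Field K] [Fintype K] (F : K → K) (c : K) : Prop :=
  cUniformity F c = 2

/-- The relative trace from the field with `p ^ n` elements to the field with `p ^ m` elements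
(for `m ∣ n`, `0 < m`), as a map into the big field: the sum of `x ^ (p ^ (m * i))`
over `0 ≤ i ≤ (n - m) / m`, i.e. over `0 ≤ i < n / m`. -/
def relTrace {K : Type*} [Field K] (p m n : ℕ) (x : K) : K :=
  ∑ i ∈ Finset.range (n / m), x ^ (p ^ (m * i))

/-- The function `X ↦ (X ^ (2 ^ m) + X + δ) ^ (2 ^ (2 m - 1) + 2 ^ (m - 1)) + X`, for `m ≥ 1`. -/
def func {K : Type*} [Field K] (m : ℕ) (δ : K) (x : K) : K :=
  (x ^ (2 ^ m) + x + δ) ^ (2 ^ (2 * m - 1) + 2 ^ (m - 1)) + x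

end CDiff

/-! With `σ` the `2 ^ m`-power map, squaring `F` is injective and turns its exponent into `2 ^ (2m)
+ 2 ^ m`. So two solutions differing by `ξ` are described by `ξ ^ 2 = cDiffTerm …`, whose right side
depends on `ξ` only through `u = σ ξ + ξ` and vanishes at `u = 0`. Adding the `σ`-image gives `u ^ 2
= t * σ u + σ (σ e) * w`, with `t` the trace of `δ`, `e = γ + σ γ` and `w = altForm σ u A` fixed by
`σ` (`sq_eq_of_sq_eq_cDiffTerm`).

If `e * w = 0`, then `u = 0` and so `ξ = 0`; this uses `m ≢ 1 (mod 3)`. It settles `c` in the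
subfield, where `e = 0`. Otherwise `w`, being additive in `ξ`, separates solutions, so it suffices
to count its values: at most two if `t = 0`, and at most four, as roots of a quartic, if `t ≠ 0`. -/

namespace CDiff
-- Algebra of the difference equation
section Abstract
variable {K : Type*} [Field K] [CharP K 2] {σ : K →+* K}

/-- The square of `func`, written with the Frobenius `σ`. -/
def sqFunc (σ : K →+* K) (δ x : K) : K :=
  σ (σ x + x + δ) * σ (σ (σ x + x + δ)) + x ^ 2

/-- The trace associated with an automorphism of order three. -/
def cubicTrace (σ : K →+* K) (x : K) : K := x + σ x + σ (σ x)

/-- The alternating form `u σ(v) + σ(u) v`. -/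
def altForm (σ : K →+* K) (u v : K) : K := u * σ v + σ u * v

/-- The right-hand side of the equation `ξ ^ 2 = …` for the difference `ξ` of two solutions, in terms
of `u = σ ξ + ξ` and `A = σ a + a`; see `sqFunc_eq_iff`. -/
def cDiffTerm (σ : K →+* K) (γ A y u : K) : K :=
  σ y * σ (σ u) + σ (σ y) * σ u + σ u * σ (σ u) + γ * (σ u * σ (σ A) + σ (σ u) * σ A)

theorem sqFunc_eq_iff (hσ : ∀ x, σ (σ (σ x)) = x) {C γ : K} (hγ : γ * (1 + C) = 1) (δ a x ξ : K) :
    sqFunc σ δ (x + ξ + a) + C * sqFunc σ δ (x + ξ) = sqFunc σ δ (x + a) + C * sqFunc σ δ x ↔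
    ξ ^ 2 = cDiffTerm σ γ (σ a + a) (σ x + x + δ) (σ ξ + ξ) := by
  have h2 : (2 : K) = 0 := CharTwo.two_eq_zero
  have hC : 1 + C ≠ 0 := right_ne_zero_of_mul_eq_one hγ
  have key : sqFunc σ δ (x + ξ + a) + C * sqFunc σ δ (x + ξ) - (sqFunc σ δ (x + a) + C * sqFunc σ δ x)
      = (1 + C) * (ξ ^ 2 - cDiffTerm σ γ (σ a + a) (σ x + x + δ) (σ ξ + ξ)) := by
    simp only [sqFunc, cDiffTerm, map_add, hσ]
    generalize σ (σ ξ) = ξ2 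
    generalize σ (σ x) = x2
    generalize σ (σ a) = a2
    generalize σ (σ δ) = d2
    generalize σ ξ = ξ1
    generalize σ x = x1
    generalize σ a = a1
    generalize σ δ = d1
    grind
  rw [← sub_eq_zero, key, mul_eq_zero, or_iff_right hC, sub_eq_zero]

theorem cDiffTerm_add_map (hσ : ∀ x, σ (σ (σ x)) = x) (γ A y u : K) (hA : cubicTrace σ A = 0)
    (hu : cubicTrace σ u = 0) :
    cDiffTerm σ γ A y u + σ (cDiffTerm σ γ A y u) =
      u ^ 2 + (σ u ^ 2 + cubicTrace σ y * σ (σ u) + (γ + σ γ) * altForm σ u A) := by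
  have h2 : (2 : K) = 0 := CharTwo.two_eq_zero
  simp only [cDiffTerm, cubicTrace, altForm, map_add, map_mul, hσ] at *
  grind

theorem cubicTrace_map_add_self (hσ : ∀ x, σ (σ (σ x)) = x) (x : K) :
    cubicTrace σ (σ x + x) = 0 := by
  have h2 : (2 : K) = 0 := CharTwo.two_eq_zero
  simp only [cubicTrace, map_add, hσ]
  grind

theorem cubicTrace_map_add_self_add (hσ : ∀ x, σ (σ (σ x)) = x) (x δ : K) :
    cubicTrace σ (σ x + x + δ) = cubicTrace σ δ := by
  have h2 : (2 : K) = 0 := CharTwo.two_eq_zero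
  simp only [cubicTrace, map_add, hσ]
  grind

omit [CharP K 2] in
theorem map_cubicTrace (hσ : ∀ x, σ (σ (σ x)) = x) (x : K) :
    σ (cubicTrace σ x) = cubicTrace σ x := by
  simp only [cubicTrace, map_add, hσ]
  ring

theorem map_altForm {u A : K} (hu : cubicTrace σ u = 0)
    (hA : cubicTrace σ A = 0) : σ (altForm σ u A) = altForm σ u A := by
  have h2 : (2 : K) = 0 := CharTwo.two_eq_zero
  simp only [cubicTrace, altForm, map_add, map_mul] at *
  grind

/-- The linearized equation satisfied by `u = σ ξ + ξ` for a difference `ξ` of two solutions. -/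
theorem sq_eq_of_sq_eq_cDiffTerm (hσ : ∀ x, σ (σ (σ x)) = x) {γ a δ x ξ : K}
    (h : ξ ^ 2 = cDiffTerm σ γ (σ a + a) (σ x + x + δ) (σ ξ + ξ)) :
    (σ ξ + ξ) ^ 2 = cubicTrace σ δ * σ (σ ξ + ξ) +
      σ (σ (γ + σ γ)) * altForm σ (σ ξ + ξ) (σ a + a) := by
  have h2 : (2 : K) = 0 := CharTwo.two_eq_zero
  have hA := cubicTrace_map_add_self hσ a
  have hu := cubicTrace_map_add_self hσ ξ
  have key := cDiffTerm_add_map hσ γ (σ a + a) (σ x + x + δ) (σ ξ + ξ) hA hu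
  rw [cubicTrace_map_add_self_add hσ, ← h, map_pow] at key
  have h0 : σ (σ ξ + ξ) ^ 2 = cubicTrace σ δ * σ (σ (σ ξ + ξ)) +
      (γ + σ γ) * altForm σ (σ ξ + ξ) (σ a + a) := by
    grind
  have h1 := congrArg (fun z => σ (σ z)) h0
  simpa only [map_pow, map_add (M := K) _ (_ * _) (_ * _), map_mul, map_altForm hu hA,
    map_cubicTrace hσ, hσ] using h1

/-- For `t ≠ 0`, `v = u / t` satisfies `v ^ 2 = σ v`, so `u` is `0` or `t`; but `t` has trace `3t =
t ≠ 0`. -/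
theorem eq_zero_of_sq_eq (hsq : ∀ v, v ^ 2 = σ v → v ^ 2 = v)
    {t u : K} (ht : σ t = t) (hu : cubicTrace σ u = 0) (h : u ^ 2 = t * σ u) : u = 0 := by
  have h2 : (2 : K) = 0 := CharTwo.two_eq_zero
  rcases eq_or_ne t 0 with rfl | ht0
  · simpa using h
  have hv : (u / t) ^ 2 = u / t := hsq _ (by
    rw [map_div₀, ht, div_pow, h]; field_simp)
  have : u * (u - t) = 0 := by field_simp at hv; grind
  rcases mul_eq_zero.mp this with h0 | h0
  · exact h0
  · obtain rfl := sub_eq_zero.mp h0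
    simp only [cubicTrace, ht] at hu
    grind

theorem eq_zero_of_altForm_eq_zero (hσ : ∀ x, σ (σ (σ x)) = x)
    (hsq : ∀ v, v ^ 2 = σ v → v ^ 2 = v) {γ a δ x ξ : K}
    (h : ξ ^ 2 = cDiffTerm σ γ (σ a + a) (σ x + x + δ) (σ ξ + ξ))
    (hw : (γ + σ γ) * altForm σ (σ ξ + ξ) (σ a + a) = 0) : ξ = 0 := by
  have h1 := sq_eq_of_sq_eq_cDiffTerm hσ h
  have hz : σ (σ (γ + σ γ)) * altForm σ (σ ξ + ξ) (σ a + a) = 0 := by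
    rcases mul_eq_zero.mp hw with h0 | h0 <;> simp [h0]
  rw [hz, add_zero] at h1
  have hu := eq_zero_of_sq_eq hsq (map_cubicTrace hσ δ) (cubicTrace_map_add_self hσ ξ) h1
  rw [hu] at h
  simpa [cDiffTerm] using h

theorem altForm_sq (hσ : ∀ x, σ (σ (σ x)) = x) {e t u A : K}
    (hu : cubicTrace σ u = 0) (hA : cubicTrace σ A = 0) (ht : σ t = t)
    (h : u ^ 2 = t * σ u + σ (σ e) * altForm σ u A) :
    altForm σ u A ^ 2 = (σ A ^ 2 * σ (σ e) + A ^ 2 * e) * altForm σ u A +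
      t * (σ (σ A) ^ 2 * σ u + A ^ 2 * u) := by
  have h2 : (2 : K) = 0 := CharTwo.two_eq_zero
  have h1 := congrArg σ h
  simp only [map_pow, map_add, map_mul, map_altForm hu hA, ht, hσ] at h1
  have : altForm σ u A ^ 2 = u ^ 2 * σ A ^ 2 + σ u ^ 2 * A ^ 2 := by
    simp only [altForm]; grind
  rw [this, h, h1]
  simp only [cubicTrace] at hu hA
  generalize altForm σ u A = w
  grind

/-- Otherwise `v = σ A / A` satisfies `v ^ 2 = σ v`, so `σ A = A`, and trace zero forces `A = 0`. -/
theorem ne_zero_of_cubicTrace_eq_zero (hsq : ∀ v, v ^ 2 = σ v → v ^ 2 = v) {A : K} (hA0 : A ≠ 0) (hA : cubicTrace σ A = 0) :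
    σ A * σ (σ A) ^ 2 + A ^ 3 ≠ 0 := by
  have h2 : (2 : K) = 0 := CharTwo.two_eq_zero
  intro hD
  have hA1 : σ A ≠ 0 := by simpa using hA0
  have hA2 : σ (σ A) ≠ 0 := by simpa using hA0
  simp only [cubicTrace] at hA
  have h1 := hsq (σ A / A) (by
    rw [map_div₀, div_pow, div_eq_div_iff (by positivity) hA1]
    grind)
  have : σ A * (σ A - A) = 0 := by field_simp at h1; grind
  have := (mul_eq_zero.mp this).resolve_left hA1
  grind

/-- For `t ≠ 0` all values `w = altForm σ u A` are roots of one polynomial of degree four. -/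
theorem exists_altForm_quartic (hσ : ∀ x, σ (σ (σ x)) = x)
    (hsq : ∀ v, v ^ 2 = σ v → v ^ 2 = v) (e : K) {t A : K} (hA0 : A ≠ 0)
    (hA : cubicTrace σ A = 0) (ht : σ t = t) (ht0 : t ≠ 0) :
    ∃ p q r : K, p ≠ 0 ∧ ∀ u, cubicTrace σ u = 0 →
      u ^ 2 = t * σ u + σ (σ e) * altForm σ u A →
      p * altForm σ u A ^ 4 + q * altForm σ u A ^ 2 + r * altForm σ u A = 0 := by
  have h2 : (2 : K) = 0 := CharTwo.two_eq_zero
  set κ := σ A ^ 2 * σ (σ e) + A ^ 2 * e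
  set D := σ A * σ (σ A) ^ 2 + A ^ 3
  have hD : D ≠ 0 := ne_zero_of_cubicTrace_eq_zero hsq hA0 hA
  set R := t * D
  set P := t * σ (σ A) ^ 2 + A * κ
  have hR : R ≠ 0 := mul_ne_zero ht0 hD
  refine ⟨σ R * A ^ 2, σ R * P ^ 2 - R ^ 2 * t * σ A, -(R ^ 2 * t * σ P + R ^ 2 * σ R * σ (σ e)),
    mul_ne_zero (by simpa using hR) (pow_ne_zero _ hA0), fun u hu h => ?_⟩
  have hw := altForm_sq hσ hu hA ht h
  -- The definition of `w` and `altForm_sq` are two linear equations in `u` and `σ u`; eliminate `σ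
  -- u`.
  have hRu : R * u = P * altForm σ u A + A * altForm σ u A ^ 2 := by
    rw [hw]
    simp only [R, P, D, altForm]
    generalize σ (σ A) = A2
    grind
  -- As `σ` fixes `w`, `σ u` is also quadratic in `w`; substituting both into `h` gives the quartic.
  have hRu1 := congrArg σ hRu
  simp only [map_mul, map_add, map_pow, map_altForm hu hA] at hRu1
  generalize altForm σ u A = w at *
  have : R ^ 2 * σ R * u ^ 2 = R ^ 2 * σ R * (t * σ u + σ (σ e) * w) := by rw [h]
  have h3 : σ R * (R * u) ^ 2 = R ^ 2 * t * (σ R * σ u) + R ^ 2 * σ R * σ (σ e) * w := by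
    linear_combination this
  rw [hRu, hRu1] at h3
  have h4 : (P * w + A * w ^ 2) ^ 2 = P ^ 2 * w ^ 2 + A ^ 2 * w ^ 4 := by grind
  rw [h4] at h3
  linear_combination h3

/-- If `t = 0`, then `w = altForm σ u A` takes at most one non-zero value. -/
theorem altForm_eq_zero_or_eq (hσ : ∀ x, σ (σ (σ x)) = x) {e u A : K}
    (hu : cubicTrace σ u = 0) (hA : cubicTrace σ A = 0)
    (h : u ^ 2 = σ (σ e) * altForm σ u A) :
    altForm σ u A = 0 ∨ altForm σ u A = σ A ^ 2 * σ (σ e) + A ^ 2 * e := by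
  have hw := altForm_sq (t := 0) hσ hu hA (map_zero σ) (by simpa using h)
  rw [zero_mul, add_zero, sq, ← sub_eq_zero, ← sub_mul, mul_eq_zero, sub_eq_zero] at hw
  exact hw.symm

/-- A non-trivial pair of solutions in the case of trace zero. -/
theorem exists_sq_eq_cDiffTerm [PerfectRing K 2] (hσ : ∀ x, σ (σ (σ x)) = x) {γ δ : K}
    (hγ : σ γ ≠ γ) (hδ : cubicTrace σ δ = 0) :
    ∃ a ξ : K, ξ ≠ 0 ∧ ξ ^ 2 = cDiffTerm σ γ (σ a + a) (σ 0 + 0 + δ) (σ ξ + ξ) := by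
  have h2 : (2 : K) = 0 := CharTwo.two_eq_zero
  have hsqrt (z : K) : ∃ f, f ^ 2 = z := (bijective_frobenius K 2).2 z
  have hinj {x y : K} (h : x ^ 2 = y ^ 2) : x = y := (bijective_frobenius K 2).1 h
  have he : γ + σ γ ≠ 0 := by grind
  -- For `t = 0`, `u = f` solves the linearized equation once `w = 1`; the choice of `a` below
  -- ensures this.
  obtain ⟨f, hf⟩ := hsqrt (σ (σ (γ + σ γ)))
  have hf0 : f ≠ 0 := by
    rintro rfl
    apply he
    rw [zero_pow two_ne_zero, eq_comm, map_eq_zero, map_eq_zero] at hf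
    exact hf
  have hfT : cubicTrace σ f = 0 := by
    apply hinj
    have h1 := congrArg σ hf
    have h3 := congrArg σ h1
    simp only [cubicTrace, map_pow, map_add, hσ] at *
    grind
  set a := (σ f)⁻¹
  have hw : altForm σ f (σ a + a) = 1 := by
    have hf1 : σ f ≠ 0 := by simpa using hf0
    have hf2 : σ (σ f) ≠ 0 := by simpa using hf0
    simp only [a, altForm, map_add, map_inv₀, hσ]
    simp only [cubicTrace] at hfT
    field_simp
    grind
  have hA := cubicTrace_map_add_self hσ a
  have key := cDiffTerm_add_map hσ γ (σ a + a) (σ 0 + 0 + δ) f hA hfT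
  rw [cubicTrace_map_add_self_add hσ, hδ, hw] at key
  have hf1 : σ f ^ 2 = γ + σ γ := by rw [← map_pow, hf, hσ]
  obtain ⟨ξ, hξ⟩ := hsqrt (cDiffTerm σ γ (σ a + a) (σ 0 + 0 + δ) f)
  have hfξ : σ ξ + ξ = f := by
    apply hinj
    rw [← hξ, map_pow] at key
    grind
  refine ⟨a, ξ, ?_, ?_⟩
  · rintro rfl
    apply hf0
    simpa using hfξ.symm
  · rw [hξ, hfξ]

end Abstract

/-! ### Counting solutions over the finite field -/

section Count
variable {K : Type*} [Field K] [Fintype K] [CharP K 2] {σ : K →+* K} {m : ℕ}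

omit [Fintype K] in
theorem func_sq (hm : 0 < m) (hσm : ∀ x, σ x = x ^ 2 ^ m) (δ x : K) :
    func m δ x ^ 2 = sqFunc σ δ x := by
  have h2 : (2 : K) = 0 := CharTwo.two_eq_zero
  have hexp : (2 ^ (2 * m - 1) + 2 ^ (m - 1)) * 2 = 2 ^ m * 2 ^ m + 2 ^ m := by
    obtain ⟨j, rfl⟩ : ∃ j, m = j + 1 := ⟨m - 1, by omega⟩
    have : 2 * (j + 1) - 1 = j + j + 1 := by omega
    rw [this, Nat.add_sub_cancel]
    ring
  have : (func m δ x) ^ 2 =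
      (x ^ 2 ^ m + x + δ) ^ ((2 ^ (2 * m - 1) + 2 ^ (m - 1)) * 2) + x ^ 2 := by
    rw [func, CharTwo.add_sq, ← pow_mul]
  rw [this, hexp, pow_add, pow_mul, sqFunc, ← hσm x, ← hσm, ← hσm]
  ring

omit [Fintype K] in
theorem func_eq_iff (hm : 0 < m) (hσm : ∀ x, σ x = x ^ 2 ^ m)
    (hσ : ∀ x, σ (σ (σ x)) = x) {c γ : K} (hγ : γ * (1 + c ^ 2) = 1) (δ a x x' : K) :
    func m δ (x' + a) - c * func m δ x' = func m δ (x + a) - c * func m δ x ↔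
    (x + x') ^ 2 = cDiffTerm σ γ (σ a + a) (σ x + x + δ) (σ (x + x') + (x + x')) := by
  have hsq (z : K) : (func m δ (z + a) - c * func m δ z) ^ 2 =
      sqFunc σ δ (z + a) + c ^ 2 * sqFunc σ δ z := by
    rw [CharTwo.sub_eq_add, CharTwo.add_sq, mul_pow, func_sq hm hσm, func_sq hm hσm]
  rw [← sqFunc_eq_iff hσ hγ, CharTwo.add_cancel_left, ← hsq, ← hsq]
  exact ((frobenius_inj K 2).eq_iff).symm

/-- Solutions with equal `W`-values have a difference in the kernel of `W`, hence coincide; so `W`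
of the difference to a fixed solution injects into `s`. -/
theorem ddt_le_card {F : K → K} {c a b : K} (W : K → K) (s : Finset K)
    (hW : ∀ x y, W (x + y) = W x + W y)
    (hs : ∀ x x', F (x' + a) - c * F x' = F (x + a) - c * F x →
      W (x + x') ∈ s ∧ (W (x + x') = 0 → x + x' = 0)) : ddt F c a b ≤ s.card := by
  rw [ddt]
  rcases isEmpty_or_nonempty {x : K // F (x + a) - c * F x = b} with h | ⟨⟨x₀, h₀⟩⟩
  · simp
  · rw [← Nat.card_eq_finsetCard]
    refine Nat.card_le_card_of_injective (β := s)
      (fun x => ⟨W (x₀ + x.1), (hs x₀ x.1 (x.2.trans h₀.symm)).1⟩) fun x y hxy => ?_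
    have h1 : W x.1 = W y.1 := by simpa [hW] using hxy
    have h2 : W (x.1 + y.1) = 0 := by rw [hW, h1, CharTwo.add_self_eq_zero]
    exact Subtype.ext (CharTwo.add_eq_zero.mp ((hs x.1 y.1 (y.2.trans x.2.symm)).2 h2))

omit [CharP K 2] in
theorem cUniformity_le {F : K → K} {c : K} {n : ℕ} (h : ∀ a b, ddt F c a b ≤ n) :
    cUniformity F c ≤ n :=
  Finset.sup_le fun _ _ => h _ _

omit [CharP K 2] in
theorem ddt_le_cUniformity {F : K → K} {c : K} (hc : c ≠ 1) (a b : K) :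
    ddt F c a b ≤ cUniformity F c :=
  Finset.le_sup (f := fun p : K × K => ddt F c p.1 p.2) (b := (a, b)) (by simp [hc])

omit [CharP K 2] in
theorem one_le_cUniformity {F : K → K} {c : K} (hc : c ≠ 1) : 1 ≤ cUniformity F c := by
  refine le_trans ?_ (ddt_le_cUniformity hc 0 (F (0 + 0) - c * F 0))
  have : Nonempty {x : K // F (x + 0) - c * F x = F (0 + 0) - c * F 0} := ⟨⟨0, rfl⟩⟩
  exact Nat.card_pos

omit [CharP K 2] in
theorem two_le_cUniformity {F : K → K} {c : K} (hc : c ≠ 1) {a x y : K} (hxy : x ≠ y)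
    (h : F (y + a) - c * F y = F (x + a) - c * F x) : 2 ≤ cUniformity F c := by
  refine le_trans ?_ (ddt_le_cUniformity hc a (F (x + a) - c * F x))
  have : Nontrivial {z : K // F (z + a) - c * F z = F (x + a) - c * F x} :=
    ⟨⟨x, rfl⟩, ⟨y, h⟩, fun h => hxy (congrArg Subtype.val h)⟩
  exact Finite.one_lt_card

omit [Fintype K] in
theorem exists_mul_one_add_sq_eq_one {c : K} (hc : c ≠ 1) : ∃ γ, γ * (1 + c ^ 2) = 1 := by
  refine ⟨(1 + c ^ 2)⁻¹, inv_mul_cancel₀ fun h => hc ?_⟩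
  apply frobenius_inj K 2
  simpa [frobenius_def, eq_comm] using CharTwo.add_eq_zero.mp h

theorem isPcN_func (hm : 0 < m) (hσm : ∀ x, σ x = x ^ 2 ^ m) (hσ : ∀ x, σ (σ (σ x)) = x)
    (hsq : ∀ v, v ^ 2 = σ v → v ^ 2 = v) {c : K} (hc : c ≠ 1) (hcσ : σ c = c) (δ : K) :
    IsPcN (func m δ) c := by
  obtain ⟨γ, hγ⟩ := exists_mul_one_add_sq_eq_one hc
  have hγσ : σ γ = γ := by
    have h1 := congrArg σ hγ
    simp only [map_mul, map_add, map_one, map_pow, hcσ] at h1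
    exact mul_right_cancel₀ (right_ne_zero_of_mul_eq_one hγ) (h1.trans hγ.symm)
  refine le_antisymm (cUniformity_le fun a b => ?_) (one_le_cUniformity hc)
  refine (ddt_le_card id {0} (fun _ _ => rfl) fun x x' h => ?_).trans_eq (Finset.card_singleton _)
  have h0 := eq_zero_of_altForm_eq_zero hσ hsq ((func_eq_iff hm hσm hσ hγ δ a x x').mp h)
    (by rw [hγσ, CharTwo.add_self_eq_zero, zero_mul])
  exact ⟨by simpa using h0, fun _ => h0⟩

omit [Fintype K] in
theorem map_ne_self {c γ : K} (hγ : γ * (1 + c ^ 2) = 1) (hcσ : σ c ≠ c) : σ γ ≠ γ := by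
  intro h
  have h1 := congrArg σ hγ
  simp only [map_mul, map_add, map_one, map_pow, h] at h1
  have h2 := add_left_cancel (mul_left_cancel₀ (left_ne_zero_of_mul_eq_one hγ) (h1.trans hγ.symm))
  exact hcσ (frobenius_inj K 2 h2)

omit [Fintype K] [CharP K 2] in
theorem altForm_map_add_self_add (A x y : K) :
    altForm σ (σ (x + y) + (x + y)) A = altForm σ (σ x + x) A + altForm σ (σ y + y) A := by
  simp only [altForm, map_add]
  ring

theorem isAPcN_func (hm : 0 < m) (hσm : ∀ x, σ x = x ^ 2 ^ m) (hσ : ∀ x, σ (σ (σ x)) = x)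
    (hsq : ∀ v, v ^ 2 = σ v → v ^ 2 = v) {c : K} (hcσ : σ c ≠ c) {δ : K}
    (hδ : cubicTrace σ δ = 0) : IsAPcN (func m δ) c := by
  classical
  have hc : c ≠ 1 := by rintro rfl; simp at hcσ
  obtain ⟨γ, hγ⟩ := exists_mul_one_add_sq_eq_one hc
  refine le_antisymm (cUniformity_le fun a b => ?_) ?_
  · refine (ddt_le_card (fun z => altForm σ (σ z + z) (σ a + a))
      {0, σ (σ a + a) ^ 2 * σ (σ (γ + σ γ)) + (σ a + a) ^ 2 * (γ + σ γ)}
      (altForm_map_add_self_add _) fun x x' h => ?_).trans Finset.card_le_two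
    have h' := (func_eq_iff hm hσm hσ hγ δ a x x').mp h
    have hu := sq_eq_of_sq_eq_cDiffTerm hσ h'
    rw [hδ, zero_mul, zero_add] at hu
    refine ⟨?_, fun hw => eq_zero_of_altForm_eq_zero hσ hsq h' (by rw [hw, mul_zero])⟩
    rw [Finset.mem_insert, Finset.mem_singleton]
    exact altForm_eq_zero_or_eq hσ (cubicTrace_map_add_self hσ _) (cubicTrace_map_add_self hσ _) hu
  · obtain ⟨a, ξ, hξ, h⟩ := exists_sq_eq_cDiffTerm hσ (map_ne_self hγ hcσ) hδ
    refine two_le_cUniformity hc (a := a) hξ.symm ((func_eq_iff hm hσm hσ hγ δ a 0 ξ).mpr ?_)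
    rwa [zero_add ξ]

theorem cUniformity_func_le_four (hm : 0 < m) (hσm : ∀ x, σ x = x ^ 2 ^ m)
    (hσ : ∀ x, σ (σ (σ x)) = x) (hsq : ∀ v, v ^ 2 = σ v → v ^ 2 = v) {c : K} (hc : c ≠ 1)
    {δ : K} (hδ : cubicTrace σ δ ≠ 0) : cUniformity (func m δ) c ≤ 4 := by
  classical
  obtain ⟨γ, hγ⟩ := exists_mul_one_add_sq_eq_one hc
  refine cUniformity_le fun a b => ?_
  have hA := cubicTrace_map_add_self hσ a
  rcases eq_or_ne (σ a + a) 0 with hA0 | hA0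
  · refine (ddt_le_card id {0} (fun _ _ => rfl) fun x x' h => ?_).trans
      ((Finset.card_singleton _).le.trans (by norm_num))
    have h0 := eq_zero_of_altForm_eq_zero hσ hsq ((func_eq_iff hm hσm hσ hγ δ a x x').mp h)
      (by simp [hA0, altForm])
    exact ⟨by simpa using h0, fun _ => h0⟩
  · obtain ⟨p, q, r, hp, hpqr⟩ := exists_altForm_quartic hσ hsq (γ + σ γ) hA0 hA
      (map_cubicTrace hσ δ) hδ
    let f : Polynomial K := .C p * .X ^ 4 + .C q * .X ^ 2 + .C r * .X
    have hdeg : f.natDegree = 4 := by simp only [f]; compute_degree!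
    have hf : f ≠ 0 := Polynomial.ne_zero_of_natDegree_gt (n := 3) (by omega)
    refine (ddt_le_card (fun z => altForm σ (σ z + z) (σ a + a)) f.roots.toFinset
      (altForm_map_add_self_add _) fun x x' h => ?_).trans
      ((Multiset.toFinset_card_le _).trans ((Polynomial.card_roots' f).trans_eq hdeg))
    have h' := (func_eq_iff hm hσm hσ hγ δ a x x').mp h
    refine ⟨?_, fun hw => eq_zero_of_altForm_eq_zero hσ hsq h' (by rw [hw, mul_zero])⟩
    rw [Multiset.mem_toFinset, Polynomial.mem_roots hf]
    simpa [f] using hpqr _ (cubicTrace_map_add_self hσ _) (sq_eq_of_sq_eq_cDiffTerm hσ h')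

omit [Fintype K] in
/-- If `m ≢ 1 (mod 3)`, then `v ^ 2 = v ^ (2 ^ m)` only for `v = 0, 1`. -/
theorem sq_eq_self_of_sq_eq (hσm : ∀ x, σ x = x ^ 2 ^ m) (hσ : ∀ x, σ (σ (σ x)) = x)
    (hm3 : ¬ m ≡ 1 [MOD 3]) {v : K} (h : v ^ 2 = σ v) : v ^ 2 = v := by
  -- Since `σ` squares `v` and has cube the identity, `v` lies in the field of 8 elements, where
  -- only `m % 3` matters.
  have h8 : v ^ 8 = v := by
    have h3 := hσ v
    rw [← h, map_pow, ← h, map_pow, map_pow, ← h] at h3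
    linear_combination h3
  have h8j (j : ℕ) : v ^ 8 ^ j = v := by
    induction j with
    | zero => simp
    | succ j ih => rw [pow_succ, pow_mul, ih, h8]
  rw [hσm, ← Nat.div_add_mod m 3, pow_add, pow_mul, pow_mul] at h
  norm_num only [h8j] at h
  have : m % 3 < 3 := Nat.mod_lt _ (by norm_num)
  have hm1 : m % 3 ≠ 1 := hm3
  interval_cases hr : m % 3
  · simpa using h
  · exact absurd rfl hm1
  · exact (frobenius_inj K 2 (h.trans (by rw [frobenius_def]; ring))).symm

end Count

/-! ### The subfield as the roots of `X ^ q - X`, and the main theorem -/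

theorem mem_subfield_iff_pow_eq {K : Type*} [Field K] [Fintype K] (k : Subfield K) {q : ℕ}
    (hk : Nat.card k = q) (x : K) : x ∈ k ↔ x ^ q = x := by
  classical
  have : Fintype k := Fintype.ofFinite k
  rw [Nat.card_eq_fintype_card] at hk
  have hq : 1 < q := hk ▸ Fintype.one_lt_card
  have hpow (y : k) : (y : K) ^ q = y := by
    rw [← hk, ← SubmonoidClass.coe_pow, FiniteField.pow_card]
  refine ⟨fun hx => hpow ⟨x, hx⟩, fun hx => ?_⟩
  have hne := FiniteField.X_pow_card_sub_X_ne_zero K hq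
  have hroot {y : K} (hy : y ^ q = y) :
      y ∈ (Polynomial.X ^ q - Polynomial.X : Polynomial K).roots.toFinset := by
    simp [hne, hy]
  have hsub : Finset.univ.image ((↑) : k → K) ⊆
      (Polynomial.X ^ q - Polynomial.X : Polynomial K).roots.toFinset := by
    intro y hy
    obtain ⟨z, -, rfl⟩ := Finset.mem_image.mp hy
    exact hroot (hpow z)
  have heq := Finset.eq_of_subset_of_card_le hsub (by
    rw [Finset.card_image_of_injective _ Subtype.val_injective, Finset.card_univ, hk]
    exact (Multiset.toFinset_card_le _).trans ((Polynomial.card_roots' _).trans_eq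
      (FiniteField.X_pow_card_sub_X_natDegree_eq K hq)))
  have hx' := hroot hx
  rw [← heq] at hx'
  obtain ⟨z, -, rfl⟩ := Finset.mem_image.mp hx'
  exact z.2

end CDiff

theorem theorem3p4 (m : ℕ) (hm : 0 < m) (hm3 : ¬ m ≡ 1 [MOD 3])
    {K : Type*} [Field K] [Fintype K] (hK : Fintype.card K = 2 ^ (3 * m))
    (k : Subfield K) (hk : Nat.card k = 2 ^ m) :
    (∀ c ∈ k, c ≠ 1 → ∀ δ : K, CDiff.IsPcN (CDiff.func m δ) c) ∧
    (∀ c ∉ k, ∀ δ : K, CDiff.relTrace 2 m (3 * m) δ = 0 →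
      CDiff.IsAPcN (CDiff.func m δ) c) ∧
    (∀ c ∉ k, ∀ δ : K, CDiff.relTrace 2 m (3 * m) δ ≠ 0 →
      CDiff.cUniformity (CDiff.func m δ) c ≤ 4) := by
  have : Fact (Nat.Prime 2) := ⟨Nat.prime_two⟩
  have : CharP K 2 := charP_of_card_eq_prime_pow hK
  set σ : K →+* K := iterateFrobenius K 2 m
  have hσm (x : K) : σ x = x ^ 2 ^ m := iterateFrobenius_def 2 m x
  have hσ (x : K) : σ (σ (σ x)) = x := by
    rw [hσm, hσm, hσm, ← pow_mul, ← pow_mul, ← pow_add, ← pow_add,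
      show m + (m + m) = 3 * m by ring, ← hK, FiniteField.pow_card]
  have hsq (v : K) : v ^ 2 = σ v → v ^ 2 = v := CDiff.sq_eq_self_of_sq_eq hσm hσ hm3
  have hmem (x : K) : x ∈ k ↔ σ x = x := by rw [CDiff.mem_subfield_iff_pow_eq k hk, hσm]
  have htr (x : K) : CDiff.relTrace 2 m (3 * m) x = CDiff.cubicTrace σ x := by
    rw [CDiff.relTrace, Nat.mul_div_cancel _ hm, CDiff.cubicTrace, hσm, hσm, ← pow_mul, ← pow_add]
    simp [Finset.sum_range_succ, mul_two]
  simp only [hmem, htr]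
  exact ⟨fun c hcσ hc δ => CDiff.isPcN_func hm hσm hσ hsq hc hcσ δ,
    fun c hcσ δ hδ => CDiff.isAPcN_func hm hσm hσ hsq hcσ hδ,
    fun c hcσ δ hδ => CDiff.cUniformity_func_le_four hm hσm hσ hsq
      (by rintro rfl; simp at hcσ) hδ⟩
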